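/- Let \(\mathbb F_2\) be the field with two elements. An \((s,k,m,t,\ell)\) batch array code is an encoding map \(\mathcal E:\mathbb F_2^s\to(\mathbb F_2^t)^m\), which encodes \(s\) information bits \(x_1,\dots,x_s\) into a \(t\times m\) array, such that for every multiset request of \(k\) information bits \(i_1,\dots,i_k\in\{1,\dots,s\}\) there is a partition of the \(m\) columns (buckets) into \(k\) sets \(S_1,\dots,S_k\) such that, for each \(j\), the bit \(x_{i_j}\) is determined by (is a function of) at most \(\ell\) cells from each column in \(S_j\), where the choice of these cells does not depend on the values of the information bits. Let \(B_{t,\ell}(s,k)\) be the smallest \(m\) for which an \((s,k,m,t,\ell)\) batch array code exists. Let \(\mathcal C^A_2\) be the following code with \(6\) information bits and \(25\) buckets of two cells each. The first \(15\) buckets are indexed by the pairs \(1\le a<b\le 6\), and the bucket of \(\{a,b\}\) stores \(x_a\) and \(x_b\). The last \(10\) buckets are indexed by the \(10\) partitions of \(\{1,\dots,6\}\) into two complementary triples \(\{a,b,c\},\{d,e,f\}\), and the corresponding bucket stores \(x_a+x_b+x_c\) and \(x_d+x_e+x_f\). Theorem. The code \(\mathcal C^A_2\) is a \((6,15,25,2,2)\)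 batch array code. Moreover, \(B_{2,2}(6,15)=25\). -/

import Mathlib

/-- An encoding map `(𝔽₂)^s → ((𝔽₂)^t)^m`: it encodes `s` information bits into a `t × m` array;
`E x j r` is the cell in row `r` of column (bucket) `j`. -/
abbrev ArrayEncoding (s m t : ℕ) : Type :=
  (Fin s → ZMod 2) → Fin m → Fin t → ZMod 2

/-- The information bit `x_i` can be recovered from the columns in `S` by reading at most `ℓ` cells
of each of them: there are a choice `R j` of at most `ℓ` cells for every column `j ∈ S` and a
decoding function `D` that computes `x_i` from the contents of the cells that are read. -/
def IsRecoveringSet {s m t : ℕ} (E : ArrayEncoding s m t) (ℓ : ℕ) (i : Fin s)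
    (S : Finset (Fin m)) : Prop :=
  ∃ R : Fin m → Finset (Fin t), (∀ j ∈ S, (R j).card ≤ ℓ) ∧
    ∃ D : ((j : {j // j ∈ S}) → {r // r ∈ R j.1} → ZMod 2) → ZMod 2,
      ∀ x : Fin s → ZMod 2, D (fun j r => E x j.1 r.1) = x i

/-- `E` is the encoding map of an `(s, k, m, t, ℓ)` batch array code: for every request
`i_1, …, i_k` of information bits (repetitions allowed) the columns can be partitioned into
sets `S_1, …, S_k` such that `S_j` is a recovering set of the bit `i_j`. -/
def IsBatchArrayCode {s m t : ℕ} (E : ArrayEncoding s m t) (k ℓ : ℕ) : Prop :=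
  ∀ i : Fin k → Fin s, ∃ S : Fin k → Finset (Fin m),
    (∀ a b : Fin k, a ≠ b → Disjoint (S a) (S b)) ∧
    (∀ j : Fin m, ∃ a : Fin k, j ∈ S a) ∧
    ∀ a : Fin k, IsRecoveringSet E ℓ (i a) (S a)

/-- `B_{t,ℓ}(s,k)`: the smallest `m` such that an `(s, k, m, t, ℓ)` batch array code exists. -/
noncomputable def batchNumber (t ℓ s k : ℕ) : ℕ :=
  sInf {m : ℕ | ∃ E : ArrayEncoding s m t, IsBatchArrayCode E k ℓ}

/-- The contents of the 25 buckets with two cells each of the code `C^A_2`; a cell is given by the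
set of the information bits that are summed in it, and the bits `x_1, …, x_6` are numbered
`0, …, 5`. The first 15 buckets hold all pairs of bits, the last 10 buckets hold the sums over all
pairs of complementary triples. -/
def codeA2Cells : Fin 25 → Fin 2 → Finset (Fin 6) :=
  ![![{0}, {1}], ![{0}, {2}], ![{0}, {3}], ![{0}, {4}], ![{0}, {5}],
    ![{1}, {2}], ![{1}, {3}], ![{1}, {4}], ![{1}, {5}],
    ![{2}, {3}], ![{2}, {4}], ![{2}, {5}],
    ![{3}, {4}], ![{3}, {5}],
    ![{4}, {5}],
    ![{0, 1, 2}, {3, 4, 5}], ![{0, 1, 3}, {2, 4, 5}], ![{0, 1, 4}, {2, 3, 5}],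
    ![{0, 1, 5}, {2, 3, 4}], ![{0, 2, 3}, {1, 4, 5}], ![{0, 2, 4}, {1, 3, 5}],
    ![{0, 2, 5}, {1, 3, 4}], ![{0, 3, 4}, {1, 2, 5}], ![{0, 3, 5}, {1, 2, 4}],
    ![{0, 4, 5}, {1, 2, 3}]]

/-- The code `C^A_2`. -/
def codeA2 : ArrayEncoding 6 25 2 :=
  fun x j r => ∑ i ∈ codeA2Cells j r, x i

/-! Lower bound. Let c(j) ≤ 2 be the number of bits that column j determines alone, and C the sum of
all c(j). Request one bit i fifteen times. A recovering set with no column giving i alone has at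
least two columns, so m plus the number of columns giving i is at least 30; summing over i, 6m + C ≥
180. A finer weighting (`sum_pairs_add_four_le`) uses that columns with c = 2 depend only on their
two bits, hence recover no third bit without a column of another type, and that such a helper serves
few bits (`card_helps_add_le`). It yields 5C + 360 ≤ 22m. Eliminating C, 52m ≥ 1260, so m ≥ 25.

Construction. Each request i gets its own pair bucket {a, b}: x_i is read there if i is a or b, and
otherwise obtained by adding x_a and x_b to the triple sum x_a + x_b + x_i. It suffices that the
triple buckets used are distinct (`servable_of_injective`). Permuting bits and requests leaves only
the multiplicities of the bits, a partition of 15 into at most six parts; a suitable assignment is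
listed for each partition and checked by computation. -/

open Finset

/-- The bit `x_i` is a function of the contents of the columns in `S`. -/
def DeterminedBy {s m t : ℕ} (E : ArrayEncoding s m t) (S : Finset (Fin m)) (i : Fin s) : Prop :=
  ∀ x y : Fin s → ZMod 2, (∀ j ∈ S, E x j = E y j) → x i = y i

theorem IsRecoveringSet.determinedBy {s m t ℓ : ℕ} {E : ArrayEncoding s m t} {i : Fin s}
    {S : Finset (Fin m)} (h : IsRecoveringSet E ℓ i S) : DeterminedBy E S i := by
  obtain ⟨R, -, D, hD⟩ := h
  intro x y hxy
  rw [← hD x, ← hD y]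
  congr 1
  funext j r
  rw [hxy j.1 j.2]

theorem DeterminedBy.isRecoveringSet {s m t : ℕ} {E : ArrayEncoding s m t} {i : Fin s}
    {S : Finset (Fin m)} (h : DeterminedBy E S i) : IsRecoveringSet E t i S := by
  classical
  refine ⟨fun _ => univ, fun _ _ => by simp, fun c =>
    if hc : ∃ x : Fin s → ZMod 2, (fun (j : {j // j ∈ S}) (r : {r // r ∈ univ}) => E x j.1 r.1) = c
    then hc.choose i else 0, fun x => ?_⟩
  have hc : ∃ y : Fin s → ZMod 2, (fun (j : {j // j ∈ S}) (r : {r // r ∈ (univ : Finset (Fin t))}) =>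
    E y j.1 r.1) = fun j r => E x j.1 r.1 := ⟨x, rfl⟩
  simp only [dif_pos hc]
  refine h _ _ fun j hj => funext fun r => ?_
  exact congrFun (congrFun hc.choose_spec ⟨j, hj⟩) ⟨r, mem_univ r⟩

theorem DeterminedBy.mono {s m t : ℕ} {E : ArrayEncoding s m t} {i : Fin s}
    {S T : Finset (Fin m)} (h : DeterminedBy E S i) (hST : S ⊆ T) : DeterminedBy E T i :=
  fun x y hxy => h x y fun j hj => hxy j (hST hj)

theorem not_determinedBy_of_update {s m t : ℕ} {E : ArrayEncoding s m t} {i : Fin s}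
    {S : Finset (Fin m)} (h : ∀ j ∈ S, E 0 j = E (Function.update 0 i 1) j) :
    ¬ DeterminedBy E S i := by
  intro hd
  have := hd _ _ h
  simp at this

/-! ### Lower bound: double counting over recovering sets -/

section LowerBound

open Classical in
/-- The bits that are determined by the column `j` alone. -/
noncomputable def columnBits {s m t : ℕ} (E : ArrayEncoding s m t) (j : Fin m) : Finset (Fin s) :=
  univ.filter fun i => DeterminedBy E {j} i

variable {s m : ℕ} {E : ArrayEncoding s m 2}

theorem mem_columnBits {j : Fin m} {i : Fin s} :
    i ∈ columnBits E j ↔ ∀ x y : Fin s → ZMod 2, E x j = E y j → x i = y i := by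
  simp [columnBits, DeterminedBy]

open Classical in
theorem injective_column_extend (j : Fin m) :
    Function.Injective fun v : columnBits E j → ZMod 2 =>
      E (fun i => if h : i ∈ columnBits E j then v ⟨i, h⟩ else 0) j := by
  intro v w hvw
  funext i
  have := mem_columnBits.1 i.2 _ _ hvw
  simpa using this

theorem card_columnBits_le (j : Fin m) : (columnBits E j).card ≤ 2 := by
  have h := Fintype.card_le_of_injective _ (injective_column_extend (E := E) j)
  simp only [Fintype.card_pi, ZMod.card, prod_const, card_univ, Fintype.card_coe,
    Fintype.card_fin] at h
  exact (Nat.pow_le_pow_iff_right (by norm_num)).1 h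

/-- A column that determines two bits is a function of these bits. -/
theorem column_eq_of_eqOn {j : Fin m} (hj : (columnBits E j).card = 2) {x y : Fin s → ZMod 2}
    (hxy : ∀ i ∈ columnBits E j, x i = y i) : E x j = E y j := by
  classical
  have hb := (Fintype.bijective_iff_injective_and_card _).2
    ⟨injective_column_extend (E := E) j, by simp [hj]⟩
  have key : ∀ z : Fin s → ZMod 2,
      E (fun i => if i ∈ columnBits E j then z i else 0) j = E z j := by
    intro z
    -- By counting, every column content arises from an extension by zero; equal contents force `v`
    -- to agree with `z` on the determined bits.
    obtain ⟨v, hv⟩ := hb.2 (E z j)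
    rw [← hv]
    congr 1
    funext i
    split_ifs with hi
    · simpa [hi] using (mem_columnBits.1 hi _ _ hv).symm
    · rfl
  rw [← key x, ← key y]
  congr 1
  funext i
  split_ifs with hi
  · exact hxy i hi
  · rfl

theorem column_update_eq {j : Fin m} (hj : (columnBits E j).card = 2) {i : Fin s}
    (hi : i ∉ columnBits E j) (x : Fin s → ZMod 2) (v : ZMod 2) :
    E x j = E (Function.update x i v) j :=
  column_eq_of_eqOn hj fun d hd => by
    rw [Function.update_of_ne]
    rintro rfl
    exact hi hd

/-- Columns that determine two bits each do not jointly determine a further bit. -/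
theorem exists_card_columnBits_ne_two {S : Finset (Fin m)} {i : Fin s} (hS : DeterminedBy E S i)
    (hi : ∀ j ∈ S, i ∉ columnBits E j) : ∃ j ∈ S, (columnBits E j).card ≠ 2 := by
  by_contra! h
  exact not_determinedBy_of_update (fun j hj => column_update_eq (h j hj) (hi j hj) _ _) hS

/-- The column `j`, which determines at most one bit, but not `x_i`, recovers `x_i` together with a
column that determines two other bits. -/
def Helps (E : ArrayEncoding s m 2) (j : Fin m) (i : Fin s) : Prop :=
  (columnBits E j).card ≠ 2 ∧ i ∉ columnBits E j ∧
    ∃ p : Fin m, (columnBits E p).card = 2 ∧ i ∉ columnBits E p ∧ DeterminedBy E {j, p} i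

/-- Varying x_a and x_i gives four distinct contents of column j: j reveals x_a, and then j with p
reveals x_i, as p ignores x_i. These are all possible contents, so the content for `y` is among
them, and decoding identifies it as that for `x`. -/
theorem column_eq_of_helps {j p : Fin m} {a i : Fin s} (ha : a ∈ columnBits E j)
    (hij : i ∉ columnBits E j) (hp : (columnBits E p).card = 2) (hip : i ∉ columnBits E p)
    (hd : DeterminedBy E {j, p} i) {x y : Fin s → ZMod 2} (hxya : x a = y a) (hxyi : x i = y i)
    (hxyp : ∀ b ∈ columnBits E p, x b = y b) : E x j = E y j := by
  have hai : a ≠ i := fun h => hij (h ▸ ha)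
  have hinj : Function.Injective fun v : ZMod 2 × ZMod 2 =>
      E (Function.update (Function.update x a v.1) i v.2) j := by
    rintro ⟨α, ι⟩ ⟨α', ι'⟩ h
    have h1 := mem_columnBits.1 ha _ _ h
    simp only [Function.update_of_ne hai, Function.update_self] at h1
    subst h1
    have h2 := hd _ _ (by
      intro c hc
      rcases mem_insert.1 hc with rfl | hc
      · exact h
      · rw [mem_singleton.1 hc, ← column_update_eq hp hip, ← column_update_eq hp hip])
    simp only [Function.update_self] at h2
    simp [h2]
  obtain ⟨⟨α, ι⟩, h⟩ := ((Fintype.bijective_iff_injective_and_card _).2 ⟨hinj, by simp⟩).2 (E y j)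
  have h1 := mem_columnBits.1 ha _ _ h
  simp only [Function.update_of_ne hai, Function.update_self] at h1
  simp only [h1, ← hxya, Function.update_eq_self] at h
  have h2 := hd _ _ (by
    intro c hc
    rcases mem_insert.1 hc with rfl | hc
    · exact h
    · rw [mem_singleton.1 hc, ← column_update_eq hp hip]
      exact column_eq_of_eqOn hp hxyp)
  rw [Function.update_self, ← hxyi] at h2
  rw [← h, h2, Function.update_eq_self]

-- If j helps i through p, its content depends only on x_a, x_i and the two bits of p. Any other bit
-- it helps must be one of these; x_a is excluded because j gives it alone.
open Classical in
theorem card_helps_le_three {j : Fin m} (hj : (columnBits E j).card = 1) :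
    (univ.filter (Helps E j)).card ≤ 3 := by
  obtain ⟨a, ha⟩ := card_eq_one.1 hj
  have haj : a ∈ columnBits E j := by simp [ha]
  rcases (univ.filter (Helps E j)).eq_empty_or_nonempty with h0 | ⟨i, hi⟩
  · simp [h0]
  obtain ⟨-, hij, p, hp, hip, hd⟩ := (mem_filter.1 hi).2
  suffices h : univ.filter (Helps E j) ⊆ insert i (columnBits E p) from
    (card_le_card h).trans ((card_insert_le _ _).trans (by omega))
  intro i' hi'
  obtain ⟨-, hij', p', hp', hip', hd'⟩ := (mem_filter.1 hi').2
  by_contra hn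
  rw [mem_insert, not_or] at hn
  refine not_determinedBy_of_update (fun c hc => ?_) hd'
  rcases mem_insert.1 hc with rfl | hc
  · refine column_eq_of_helps haj hij hp hip hd ?_ ?_ fun b hb => ?_
    · rw [Function.update_of_ne]
      rintro rfl
      exact hij' haj
    · rw [Function.update_of_ne (Ne.symm hn.1)]
    · rw [Function.update_of_ne]
      rintro rfl
      exact hn.2 hb
  · rw [mem_singleton.1 hc]
    exact column_update_eq hp' hip' _ _

open Classical in
theorem card_helps_add_le {E : ArrayEncoding 6 m 2} (j : Fin m) :
    (univ.filter (Helps E j)).card + 3 * (columnBits E j).card ≤ 6 := by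
  have h2 := card_columnBits_le (E := E) j
  rcases h : (columnBits E j).card with _ | _ | _ | n
  · simpa using card_le_univ (univ.filter (Helps E j))
  · have := card_helps_le_three h
    omega
  · have : univ.filter (Helps E j) = ∅ := filter_eq_empty_iff.2 fun i _ hi => hi.1 h
    simp [this]
  · omega

theorem two_le_card_add {S : Finset (Fin m)} {i : Fin s} (hS : DeterminedBy E S i) :
    2 ≤ ∑ j ∈ S, (1 + if i ∈ columnBits E j then 1 else 0) := by
  by_cases hA : ∃ j ∈ S, i ∈ columnBits E j
  · obtain ⟨j, hj, hij⟩ := hA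
    rw [← add_sum_erase _ _ hj, if_pos hij]
    omega
  push Not at hA
  obtain ⟨j, hj, -⟩ := exists_card_columnBits_ne_two hS hA
  have hne : (S.erase j).Nonempty := by
    rw [nonempty_iff_ne_empty]
    intro h0
    rcases erase_eq_empty_iff _ _ |>.1 h0 with h | h
    · simp [h] at hj
    · exact hA j hj (mem_columnBits.2 fun x y hxy => hS x y (by simpa [h] using hxy))
  obtain ⟨k, hk⟩ := hne
  rw [← add_sum_erase _ _ hj, ← add_sum_erase _ _ hk]
  omega

-- A column giving i alone contributes 4. Otherwise some column has c ≠ 2 and contributes 2, and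
-- every further column contributes at least 2 - 1. This suffices for three columns; for two, either
-- both have c ≠ 2, or the first helps i through the second and gains 1.
open Classical in
theorem sum_pairs_add_four_le {S : Finset (Fin m)} {i : Fin s} (hS : DeterminedBy E S i) :
    (∑ j ∈ S, if (columnBits E j).card = 2 ∧ i ∉ columnBits E j then 1 else 0) + 4 ≤
      ∑ j ∈ S, ((if Helps E j i then 1 else 0) + (if i ∈ columnBits E j then 2 else 0) + 2) := by
  have hle : ∀ T : Finset (Fin m),
      (∑ j ∈ T, if (columnBits E j).card = 2 ∧ i ∉ columnBits E j then 1 else 0) ≤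
      ∑ j ∈ T, ((if Helps E j i then 1 else 0) + (if i ∈ columnBits E j then 2 else 0) + 2) :=
    fun T => sum_le_sum fun j _ => by split_ifs <;> omega
  by_cases hA : ∃ j ∈ S, i ∈ columnBits E j
  · obtain ⟨j, hj, hij⟩ := hA
    have := hle (S.erase j)
    rw [← add_sum_erase _ _ hj, ← add_sum_erase _ _ hj, if_neg (by tauto), if_pos hij]
    omega
  push Not at hA
  obtain ⟨j, hj, hj2⟩ := exists_card_columnBits_ne_two hS hA
  have hne : (S.erase j).Nonempty := by
    rw [nonempty_iff_ne_empty]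
    intro h0
    rcases erase_eq_empty_iff _ _ |>.1 h0 with h | h
    · simp [h] at hj
    · exact hA j hj (mem_columnBits.2 fun x y hxy => hS x y (by simpa [h] using hxy))
  obtain ⟨k, hk⟩ := hne
  rw [← add_sum_erase _ _ hj, ← add_sum_erase _ _ hk, ← add_sum_erase _ _ hj,
    ← add_sum_erase _ _ hk, if_neg (by tauto)]
  rcases ((S.erase j).erase k).eq_empty_or_nonempty with h0 | ⟨l, hl⟩
  · rw [h0, sum_empty, sum_empty]
    have hSjk : S = {j, k} := by
      rw [← insert_erase hj, ← insert_erase hk, h0]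
      rfl
    by_cases hk2 : (columnBits E k).card = 2
    · have hh : Helps E j i :=
        ⟨hj2, hA j hj, k, hk2, hA k (mem_of_mem_erase hk), hSjk ▸ hS⟩
      rw [if_pos hh]
      split_ifs <;> omega
    · rw [if_neg (by tauto)]
      omega
  · have := hle (((S.erase j).erase k).erase l)
    rw [← add_sum_erase _ _ hl, ← add_sum_erase _ _ hl]
    split_ifs <;> omega

theorem twentyFive_le_of_isBatchArrayCode {E : ArrayEncoding 6 m 2}
    (hE : IsBatchArrayCode E 15 2) : 25 ≤ m := by
  classical
  have hpart : ∀ i : Fin 6, ∃ S : Fin 15 → Finset (Fin m), (∀ a, DeterminedBy E (S a) i) ∧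
      ∀ g : Fin m → ℕ, ∑ j, g j = ∑ a, ∑ j ∈ S a, g j := by
    intro i
    obtain ⟨S, hdis, hcov, hrec⟩ := hE fun _ => i
    refine ⟨S, fun a => (hrec a).determinedBy, fun g => ?_⟩
    rw [← sum_biUnion fun a _ b _ hab => hdis a b hab]
    congr 1
    ext j
    simpa using hcov j
  have h1 : ∀ i : Fin 6, 30 ≤ ∑ j : Fin m, (1 + if i ∈ columnBits E j then 1 else 0) := by
    intro i
    obtain ⟨S, hS, hsum⟩ := hpart i
    rw [hsum]
    exact (by simp : 30 ≤ ∑ _a : Fin 15, 2).trans (sum_le_sum fun a _ => two_le_card_add (hS a))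
  have h2 : ∀ i : Fin 6,
      (∑ j : Fin m, if (columnBits E j).card = 2 ∧ i ∉ columnBits E j then 1 else 0) + 60 ≤
      ∑ j : Fin m,
        ((if Helps E j i then 1 else 0) + (if i ∈ columnBits E j then 2 else 0) + 2) := by
    intro i
    obtain ⟨S, hS, hsum⟩ := hpart i
    rw [hsum, hsum]
    have := sum_le_sum fun a (_ : a ∈ univ) => sum_pairs_add_four_le (hS a)
    rw [sum_add_distrib] at this
    simpa using this
  have h3 := sum_le_sum fun i (_ : i ∈ (univ : Finset (Fin 6))) => h1 i
  have h4 := sum_le_sum fun i (_ : i ∈ (univ : Finset (Fin 6))) => h2 i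
  rw [sum_comm] at h3
  have hbits : ∀ (j : Fin m) (c : ℕ),
      (∑ i : Fin 6, if i ∈ columnBits E j then c else 0) = c * (columnBits E j).card := by
    intro j c
    rw [← sum_filter, sum_const, smul_eq_mul, mul_comm, filter_mem_eq_inter, univ_inter]
  -- Since c ≤ 2, 4c - 4 is a linear lower bound for the number of bits (4 of 6, when c = 2) that a
  -- pair column misses.
  have hP : ∀ j : Fin m, 4 * (columnBits E j).card ≤
      (∑ i : Fin 6, if (columnBits E j).card = 2 ∧ i ∉ columnBits E j then 1 else 0) + 4 := by
    intro j
    have hc := card_columnBits_le (E := E) j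
    by_cases h : (columnBits E j).card = 2
    · have : (univ.filter fun i => i ∉ columnBits E j).card = 4 := by
        rw [filter_notMem_eq_sdiff, card_sdiff_of_subset (subset_univ _), h]
        rfl
      simp only [h, true_and, ← card_filter, this]
      omega
    · omega
  have hP' := sum_le_sum fun j (_ : j ∈ (univ : Finset (Fin m))) => hP j
  have hH : ∀ j : Fin m, (∑ i : Fin 6,
      ((if Helps E j i then 1 else 0) + (if i ∈ columnBits E j then 2 else 0) + 2)) +
        (columnBits E j).card ≤ 18 := by
    intro j
    have := card_helps_add_le (E := E) j
    rw [card_filter] at this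
    rw [sum_add_distrib, sum_add_distrib, hbits]
    simp only [sum_const, card_univ, Fintype.card_fin, smul_eq_mul]
    omega
  have hH' := sum_le_sum fun j (_ : j ∈ (univ : Finset (Fin m))) => hH j
  have c1 := sum_comm (s := univ) (t := univ) (f := fun (i : Fin 6) (j : Fin m) =>
    if (columnBits E j).card = 2 ∧ i ∉ columnBits E j then 1 else 0)
  have c2 := sum_comm (s := univ) (t := univ) (f := fun (i : Fin 6) (j : Fin m) =>
    if Helps E j i then 1 else 0)
  have c3 := sum_comm (s := univ) (t := univ) (f := fun (i : Fin 6) (j : Fin m) =>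
    if i ∈ columnBits E j then 2 else 0)
  simp only [sum_add_distrib, hbits, sum_const, card_univ, Fintype.card_fin, smul_eq_mul,
    ← mul_sum] at h3 h4 hP' hH' c1 c2 c3
  -- `h3` reads 180 ≤ 6m + C. The others give 4C - 4m + 360 ≤ 18m - C.
  omega

end LowerBound
-- The code serves every request
section Code

/-- The request `i` can be served by the code `C^A_2`. -/
def Servable (i : Fin 15 → Fin 6) : Prop :=
  ∃ S : Fin 15 → Finset (Fin 25), (∀ a b, a ≠ b → Disjoint (S a) (S b)) ∧
    (∀ j, ∃ a, j ∈ S a) ∧ ∀ a, DeterminedBy codeA2 (S a) (i a)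

theorem Servable.comp_perm {i : Fin 15 → Fin 6} (h : Servable i) (ρ : Equiv.Perm (Fin 15)) :
    Servable (i ∘ ρ) := by
  obtain ⟨S, hd, hc, hr⟩ := h
  refine ⟨S ∘ ρ, fun a b hab => hd _ _ (ρ.injective.ne hab), fun j => ?_, fun a => hr _⟩
  obtain ⟨a, ha⟩ := hc j
  exact ⟨ρ.symm a, by simpa using ha⟩

/-- The permutation `τ` of the bits maps the cells of every column to the cells of a column. -/
def PreservesColumns (τ : Equiv.Perm (Fin 6)) : Prop :=
  ∀ j, ∃ j', ∀ r, ∃ r', codeA2Cells j' r' = (codeA2Cells j r).map τ.toEmbedding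

/-- Transpositions generate all permutations, so only these need a computation. -/
theorem preservesColumns_swap (a b : Fin 6) : PreservesColumns (Equiv.swap a b) := by
  revert a b
  unfold PreservesColumns
  decide +kernel

theorem preservesColumns (τ : Equiv.Perm (Fin 6)) : PreservesColumns τ := by
  induction τ using Equiv.Perm.swap_induction_on with
  | one => exact fun j => ⟨j, fun r => ⟨r, map_refl.symm⟩⟩
  | swap_mul τ a b _ ih =>
    intro j
    obtain ⟨j', h⟩ := ih j
    obtain ⟨j'', h'⟩ := preservesColumns_swap a b j'
    refine ⟨j'', fun r => ?_⟩
    obtain ⟨r', hr⟩ := h r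
    obtain ⟨r'', hr'⟩ := h' r'
    refine ⟨r'', ?_⟩
    rw [hr', hr, map_map]
    rfl

/-- Ensures that the column map induced by τ⁻¹ undoes the one induced by τ. -/
theorem column_eq_of_cells_subset :
    ∀ j j' : Fin 25, (∀ r, ∃ r', codeA2Cells j' r' = codeA2Cells j r) → j' = j := by
  decide +kernel

theorem Servable.relabel {i : Fin 15 → Fin 6} (h : Servable i) (τ : Equiv.Perm (Fin 6)) :
    Servable (τ ∘ i) := by
  obtain ⟨S, hd, hc, hr⟩ := h
  choose π hπ using preservesColumns τ
  choose π' hπ' using preservesColumns τ.symm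
  have hinv : ∀ j, π' (π j) = j := fun j => column_eq_of_cells_subset _ _ fun r => by
    obtain ⟨r', h⟩ := hπ j r
    obtain ⟨r'', h'⟩ := hπ' (π j) r'
    exact ⟨r'', by rw [h', h, map_map]; ext; simp⟩
  refine ⟨fun a => univ.filter fun j => π' j ∈ S a, fun a b hab => ?_, fun j => ?_,
    fun a x y hxy => ?_⟩
  · exact disjoint_filter.2 fun j _ ha hb => disjoint_left.1 (hd a b hab) ha hb
  · simpa using hc (π' j)
  · refine hr a (x ∘ τ) (y ∘ τ) fun j hj => funext fun r => ?_
    obtain ⟨r', h⟩ := hπ j r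
    have := congrFun (hxy (π j) (by simpa [hinv] using hj)) r'
    simpa [codeA2, h] using this

/-- For a column `n` that stores `x_a` and `x_b`, and a bit `i`: the column that stores
`x_a + x_b + x_i` if `i` is different from `a` and `b`, and the column `n` otherwise. -/
def partnerColumn : Fin 15 → Fin 6 → Fin 25 :=
  ![![0, 0, 15, 16, 17, 18], ![1, 15, 1, 19, 20, 21], ![2, 16, 19, 2, 22, 23],
    ![3, 17, 20, 22, 3, 24], ![4, 18, 21, 23, 24, 4], ![15, 5, 5, 24, 23, 22],
    ![16, 6, 24, 6, 21, 20], ![17, 7, 23, 21, 7, 19], ![18, 8, 22, 20, 19, 8],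
    ![19, 24, 9, 9, 18, 17], ![20, 23, 10, 18, 10, 16], ![21, 22, 11, 17, 16, 11],
    ![22, 21, 18, 12, 12, 15], ![23, 20, 17, 13, 15, 13], ![24, 19, 16, 15, 14, 14]]

theorem partnerColumn_spec : ∀ (n : Fin 15) (i : Fin 6),
    (∃ r, codeA2Cells (n.castLE (by norm_num)) r = {i}) ∨
    ∃ a b r, codeA2Cells (n.castLE (by norm_num)) 0 = {a} ∧
      codeA2Cells (n.castLE (by norm_num)) 1 = {b} ∧
      codeA2Cells (partnerColumn n i) r = {a, b, i} ∧ a ≠ b ∧ a ≠ i ∧ b ≠ i := by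
  decide +kernel

theorem partnerColumn_eq_or_le : ∀ (n : Fin 15) (i : Fin 6),
    (partnerColumn n i : ℕ) = n ∨ 15 ≤ (partnerColumn n i : ℕ) := by
  decide +kernel

theorem determinedBy_partnerColumn (n : Fin 15) (i : Fin 6) :
    DeterminedBy codeA2 {n.castLE (by norm_num), partnerColumn n i} i := by
  intro x y hxy
  have h1 := hxy _ (mem_insert_self _ _)
  have h2 := hxy (partnerColumn n i) (by simp)
  rcases partnerColumn_spec n i with ⟨r, hr⟩ | ⟨a, b, r, ha, hb, hr, hab, hai, hbi⟩
  · simpa [codeA2, hr] using congrFun h1 r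
  · have ha' := congrFun h1 0
    have hb' := congrFun h1 1
    have hr' := congrFun h2 r
    simp only [codeA2, ha, hb, hr, sum_singleton] at ha' hb' hr'
    rw [sum_insert (by simp [hab, hai]), sum_insert (by simpa using hbi), sum_insert
      (by simp [hab, hai]), sum_insert (by simpa using hbi), ha', hb'] at hr'
    simpa using hr'

theorem servable_of_injective {f : Fin 15 → Fin 6}
    (hf : Function.Injective fun n => partnerColumn n (f n)) : Servable f := by
  classical
  -- Triple columns that no request needs go to request 0, so that the sets cover all columns.
  let owner : Fin 25 → Fin 15 := fun j =>
    if h : (j : ℕ) < 15 then ⟨j, h⟩ else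
      if h : ∃ n, partnerColumn n (f n) = j then h.choose else 0
  have h1 : ∀ n : Fin 15, owner (n.castLE (by norm_num)) = n := fun n => by
    simp [owner]
  have h2 : ∀ n, owner (partnerColumn n (f n)) = n := fun n => by
    rcases partnerColumn_eq_or_le n (f n) with h | h
    · simp [owner, h]
    · have hex : ∃ n', partnerColumn n' (f n') = partnerColumn n (f n) := ⟨n, rfl⟩
      simp only [owner, dif_neg h.not_gt, dif_pos hex]
      exact hf hex.choose_spec
  refine ⟨fun n => univ.filter fun j => owner j = n, fun a b hab => ?_, fun j => ?_, fun n => ?_⟩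
  · exact disjoint_filter.2 fun j _ ha hb => hab (ha.symm.trans hb)
  · simp
  · refine (determinedBy_partnerColumn n (f n)).mono fun j hj => ?_
    rcases mem_insert.1 hj with rfl | hj
    · simp [h1]
    · rw [mem_singleton.1 hj]
      simp [h2]

/-- The assignment of bits to pairs that is given by the digits of `N` in base `6`. -/
def digitAssignment (N : ℕ) (n : Fin 15) : Fin 6 :=
  Fin.ofNat 6 (N / 6 ^ (n : ℕ))

/-- How often each bit occurs in a request. -/
def multiplicities (f : Fin 15 → Fin 6) : List ℕ :=
  (List.finRange 6).map fun c => (univ.filter fun n => f n = c).card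

/-- Assignments with pairwise different partner columns, one for each of the partitions of `15` into
at most six parts. -/
def assignments : List ℕ :=
  [385895954558, 379571592296, 355574790200, 363241900446, 333343894398, 408409292022,
   330045127926, 386080104282, 386079963450, 127059801594, 355662121578, 385653934334,
   353366644862, 118302706046, 432653081400, 353482840116, 127090757844, 361790219988,
   355329580932, 433805085438, 355205775102, 385774773342, 333532012830, 124460131614,
   355554568734, 42178533918, 356632967706, 355544545434, 355542904698, 117632016762,
   118352563386, 79110297470, 205038378000, 385734825432, 327341295576, 385784843256,
   118529384184, 118468918008, 386078308020, 355606714548, 355605034932, 120482309556,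
   121982205780, 386076821694, 355551760446, 124812832830, 118403418174, 13909470558,
   47953092570, 117568183578, 79111695642, 205092124416, 170985841920, 385776443664,
   126389985552, 355605034896, 176413522320, 386086891608, 355554831960, 85815220824,
   198873626328, 92282024952, 355542842484, 42148331892, 81288470196, 42145212606, 16084290750,
   2904111834, 385784840448, 113389756416, 386086891392, 355554831744, 111211014528,
   200689011072, 355552873488, 118404531216, 28784140560, 118342664280, 81397830744,
   13848481908, 2541546942, 386086611456, 355554551808, 85814940672, 357366857472, 122637162240,
   107398566144, 111086722944, 105281970048, 81278299152, 91495682136, 386076533760,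
   355551192576, 118402850304, 118342384128, 81397550592, 83092283136, 91495681920,
   355541114880, 42144924672, 16084002816, 81276618240, 91495401984, 42084458496, 13846754304,
   2541259008, 2902376448, 2539579392, 1679616, 0]

theorem injective_partnerColumn_of_mem_assignments : ∀ N ∈ assignments,
    ((List.finRange 15).map fun n => partnerColumn n (digitAssignment N n)).Nodup := by
  decide +kernel

/-- The partitions of `15` into at most six parts, as lists `[a, b, c, d, e, f]` with
`a ≥ b ≥ c ≥ d ≥ e ≥ f`. -/
def sixPartPartitions : List (List ℕ) :=
  (List.range 16).flatMap fun a => (List.range (min (a + 1) (16 - a))).flatMap fun b =>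
    (List.range (min (b + 1) (16 - a - b))).flatMap fun c =>
      (List.range (min (c + 1) (16 - a - b - c))).flatMap fun d =>
        ((List.range (min (d + 1) (16 - a - b - c - d))).filter fun e =>
          15 - a - b - c - d - e ≤ e).map fun e => [a, b, c, d, e, 15 - a - b - c - d - e]

theorem mem_sixPartPartitions {a b c d e f : ℕ} (hsum : a + b + c + d + e + f = 15) (hba : b ≤ a)
    (hcb : c ≤ b) (hdc : d ≤ c) (hed : e ≤ d) (hfe : f ≤ e) :
    [a, b, c, d, e, f] ∈ sixPartPartitions := by
  obtain rfl : f = 15 - a - b - c - d - e := by omega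
  simp only [sixPartPartitions, List.mem_flatMap, List.mem_range, List.mem_map, List.mem_filter,
    decide_eq_true_eq]
  exact ⟨a, by omega, b, by omega, c, by omega, d, by omega, e, ⟨by omega, hfe⟩, rfl⟩

theorem map_multiplicities_assignments :
    (assignments.map fun N => multiplicities (digitAssignment N)) = sixPartPartitions := by
  decide +kernel

theorem exists_perm_of_multiplicities_eq {f g : Fin 15 → Fin 6}
    (h : multiplicities f = multiplicities g) : ∃ ρ : Equiv.Perm (Fin 15), f = g ∘ ρ := by
  have hc : ∀ c, Fintype.card {n // f n = c} = Fintype.card {n // g n = c} := by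
    intro c
    rw [Fintype.card_subtype, Fintype.card_subtype]
    rw [multiplicities, multiplicities, List.map_inj_left] at h
    exact h c (List.mem_finRange c)
  exact ⟨Equiv.ofFiberEquiv fun c => Fintype.equivOfCardEq (hc c),
    funext fun n => (Equiv.ofFiberEquiv_map _ n).symm⟩

theorem servable_of_antitone {f : Fin 15 → Fin 6}
    (hf : Antitone fun c => (univ.filter fun n => f n = c).card) : Servable f := by
  have hsum : ∑ c, (univ.filter fun n => f n = c).card = 15 := by
    rw [← card_eq_sum_card_fiberwise fun _ _ => by simp]
    rfl
  have hmem : multiplicities f ∈ assignments.map fun N => multiplicities (digitAssignment N) := by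
    rw [map_multiplicities_assignments, multiplicities]
    have h01 := hf (show (0 : Fin 6) ≤ 1 by decide)
    have h12 := hf (show (1 : Fin 6) ≤ 2 by decide)
    have h23 := hf (show (2 : Fin 6) ≤ 3 by decide)
    have h34 := hf (show (3 : Fin 6) ≤ 4 by decide)
    have h45 := hf (show (4 : Fin 6) ≤ 5 by decide)
    exact mem_sixPartPartitions ((Fin.sum_univ_six _).symm.trans hsum) h01 h12 h23 h34 h45
  obtain ⟨N, hN, h⟩ := List.mem_map.1 hmem
  obtain ⟨ρ, rfl⟩ := exists_perm_of_multiplicities_eq h.symm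
  refine (servable_of_injective fun n n' hnn => ?_).comp_perm ρ
  exact List.inj_on_of_nodup_map (injective_partnerColumn_of_mem_assignments N hN)
    (List.mem_finRange n) (List.mem_finRange n') hnn

theorem servable (i : Fin 15 → Fin 6) : Servable i := by
  -- The order dual makes sorting arrange the multiplicities in decreasing order.
  let k : Fin 6 → ℕᵒᵈ := fun c => OrderDual.toDual (univ.filter fun n => i n = c).card
  let τ : Equiv.Perm (Fin 6) := Tuple.sort k
  have hanti : Antitone fun c => (univ.filter fun n => (τ.symm ∘ i) n = c).card := by
    intro c d hcd
    have := Tuple.monotone_sort k hcd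
    simpa [k, τ, Equiv.symm_apply_eq] using this
  have := (servable_of_antitone hanti).relabel τ
  rwa [← Function.comp_assoc, Equiv.self_comp_symm, Function.id_comp] at this

theorem isBatchArrayCode_codeA2 : IsBatchArrayCode codeA2 15 2 := fun i =>
  let ⟨S, hd, hc, hr⟩ := servable i
  ⟨S, hd, hc, fun a => (hr a).isRecoveringSet⟩

end Code

theorem theorem17 :
    IsBatchArrayCode codeA2 15 2 ∧ batchNumber 2 2 6 15 = 25 := by
  refine ⟨isBatchArrayCode_codeA2, le_antisymm (Nat.sInf_le ⟨_, isBatchArrayCode_codeA2⟩) ?_⟩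
  exact le_csInf ⟨25, _, isBatchArrayCode_codeA2⟩ fun m ⟨_, hE⟩ =>
    twentyFive_le_of_isBatchArrayCode hE
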